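/- Let $G=(V,E)$ be a (simple, undirected) connected graph whose vertex set is countable (finite or infinite). Then the topological space $\mathrm{ETOP}(G)$, defined as follows, is compact. Regard $G$ as a 1-complex, every edge being a copy of the interval $[0,1]$. A *ray* is a one-way infinite path in $G$. Two rays are *edge-equivalent* if no finite set of edges separates them, i.e. if for every finite $S\subseteq E$ they have tails in the same component of $G-S$. The equivalence classes are the *edge-ends* of $G$; their set is denoted by $\Omega'(G)$. Let $\mathrm{ETOP}'(G)$ be the set $G\cup\Omega'(G)$ with the topology generated by the following sets: 1. for every edge $e$, the subsets of the interior of $e$ that correspond to open subsets of $(0,1)$; 2. for every finite $S\subseteq E$ and every component $C$ of $G-S$, all sets of the form $C\cup\Omega'(C)\cup E'(C)$, where $\Omega'(C)$ is the set of edge-ends of $G$ that have a ray in $C$, and $E'(C)$ is any union of half-edges $(z,y]\subset e$ with $z$ an inner point of $e$, one for every edge $e\in S$ and every endvertex $y$ of $e$ that lies in $C$. The space $\mathrm{ETOP}(G)$ is the quotient of $\mathrm{ETOP}'(G)$ obtained by identifying any two points that have the same open neighbourhoods. -/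

import Mathlib

namespace EdgeTop

variable {V : Type*}

/-- A ray (one-way infinite path) of `G`, given by the sequence of its vertices from its
first vertex on. -/
structure Ray (G : SimpleGraph V) where
  vert : ℕ → V
  injective : Function.Injective vert
  adj : ∀ n, G.Adj (vert n) (vert (n + 1))

/-- The tail of a ray that starts at its `k`-th vertex. -/
def Ray.tail {G : SimpleGraph V} (r : Ray G) (k : ℕ) : Ray G where
  vert n := r.vert (k + n)
  injective _ _ h := Nat.add_left_cancel (r.injective h)
  adj n := r.adj (k + n)

/-- The ray `r` is contained in the component `C` of `G - S`: all its vertices lie in `C`, and all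
its edges are edges of `G - S`. -/
def Ray.LiesIn {G : SimpleGraph V} (r : Ray G) {S : Set (Sym2 V)}
    (C : (G.deleteEdges S).ConnectedComponent) : Prop :=
  (∀ n, r.vert n ∈ C.supp) ∧ ∀ n, (G.deleteEdges S).Adj (r.vert n) (r.vert (n + 1))

/-- Two rays are edge-equivalent if no finite set `S` of edges separates them, that is, if for
every such `S` they have tails in the same component of `G - S`. -/
def Ray.EdgeEquiv {G : SimpleGraph V} (r r' : Ray G) : Prop :=
  ∀ S : Set (Sym2 V), S.Finite → S ⊆ G.edgeSet →
    ∃ C : (G.deleteEdges S).ConnectedComponent,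
      (∃ k, (r.tail k).LiesIn C) ∧ (∃ k, (r'.tail k).LiesIn C)

theorem Ray.exists_tail_liesIn {G : SimpleGraph V} (r : Ray G) {S : Set (Sym2 V)}
    (hS : S.Finite) :
    ∃ C : (G.deleteEdges S).ConnectedComponent, ∃ k, (r.tail k).LiesIn C := by
  have hinj : Function.Injective (fun n => s(r.vert n, r.vert (n + 1))) := by
    intro m n h
    rcases Sym2.eq_iff.1 h with ⟨h, -⟩ | ⟨h, h'⟩
    · exact r.injective h
    · have h1 := r.injective h
      have h2 := r.injective h'
      omega
  obtain ⟨k, hk⟩ := (hS.preimage hinj.injOn).bddAbove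
  have hadj : ∀ n, (G.deleteEdges S).Adj ((r.tail (k + 1)).vert n)
      ((r.tail (k + 1)).vert (n + 1)) := by
    intro n
    rw [SimpleGraph.deleteEdges_adj]
    refine ⟨(r.tail (k + 1)).adj n, fun hmem => ?_⟩
    have : k + 1 + n ≤ k := hk hmem
    omega
  refine ⟨(G.deleteEdges S).connectedComponentMk ((r.tail (k + 1)).vert 0), k + 1, ?_, hadj⟩
  intro n
  induction n with
  | zero => rfl
  | succ n ih => exact (SimpleGraph.ConnectedComponent.sound (hadj n).symm.reachable).trans ih

theorem Ray.liesIn_unique {G : SimpleGraph V} (r : Ray G) {S : Set (Sym2 V)}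
    {C D : (G.deleteEdges S).ConnectedComponent} {k l : ℕ}
    (hC : (r.tail k).LiesIn C) (hD : (r.tail l).LiesIn D) : C = D := by
  have h1 : (G.deleteEdges S).connectedComponentMk (r.vert (k + l)) = C := hC.1 l
  have h2 : (G.deleteEdges S).connectedComponentMk (r.vert (l + k)) = D := hD.1 k
  rw [← h1, ← h2, add_comm]

/-- Edge-equivalence of rays as a setoid. -/
def raySetoid (G : SimpleGraph V) : Setoid (Ray G) where
  r := Ray.EdgeEquiv
  iseqv :=
    { refl := fun r S hS _ => by
        obtain ⟨C, h⟩ := r.exists_tail_liesIn hS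
        exact ⟨C, h, h⟩
      symm := fun h S hS hSG => by
        obtain ⟨C, h1, h2⟩ := h S hS hSG
        exact ⟨C, h2, h1⟩
      trans := fun {_ y _} hxy hyz S hS hSG => by
        obtain ⟨C, h1, k, h2⟩ := hxy S hS hSG
        obtain ⟨D, ⟨l, h3⟩, h4⟩ := hyz S hS hSG
        obtain rfl := y.liesIn_unique h2 h3
        exact ⟨C, h1, h4⟩ }

/-- The edge-ends of `G`: the classes of edge-equivalent rays. -/
def EdgeEnd (G : SimpleGraph V) : Type _ := Quotient (raySetoid G)

/-- The edge-end that contains the ray `r`. -/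
def Ray.toEnd {G : SimpleGraph V} (r : Ray G) : EdgeEnd G := Quotient.mk (raySetoid G) r

/-- Every edge is identified with the unit interval; this is its endvertex at the parameter `0`. -/
noncomputable def vertexAtZero {G : SimpleGraph V} (e : G.edgeSet) : V := (Quot.out e.1).1

/-- The endvertex of the edge `e` at the parameter `1`. -/
noncomputable def vertexAtOne {G : SimpleGraph V} (e : G.edgeSet) : V := (Quot.out e.1).2

theorem mk_vertexAtZero_vertexAtOne {G : SimpleGraph V} (e : G.edgeSet) :
    s(vertexAtZero e, vertexAtOne e) = e.1 := Quot.out_eq e.1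

/-- The points of the 1-complex `G`, which are the vertices and the inner points of edges,
together with the edge-ends of `G`. -/
inductive Point (G : SimpleGraph V) : Type _
  | vertex (v : V) : Point G
  | inner (e : G.edgeSet) (t : Set.Ioo (0 : ℝ) 1) : Point G
  | edgeEnd (w : EdgeEnd G) : Point G

/-- The set of inner points of `e` with parameter in `U`. -/
def edgeOpen {G : SimpleGraph V} (e : G.edgeSet) (U : Set (Set.Ioo (0 : ℝ) 1)) :
    Set (Point G) :=
  {p | ∃ t ∈ U, p = Point.inner e t}

/-- The set `C ∪ Ω'(C) ∪ E'(C)` for a component `C` of `G - S`. It consists of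
* the vertices of `C`;
* the inner points of the edges of `C`, which are the edges outside `S` with an endvertex in `C`
  (and so with both);
* for every edge `e` in `S` and each endvertex `y` of `e` in `C`, the inner points of a half-edge
  `(z, y]` of `e`, where `z` has the parameter `a e` if `y` is the endvertex at `0`, and the
  parameter `b e` if `y` is the endvertex at `1`;
* the edge-ends that have a ray in `C`. -/
def componentOpen {G : SimpleGraph V} {S : Set (Sym2 V)}
    (C : (G.deleteEdges S).ConnectedComponent) (a b : G.edgeSet → Set.Ioo (0 : ℝ) 1) :
    Set (Point G) :=
  {p | match p with
    | Point.vertex v => v ∈ C.supp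
    | Point.inner e t =>
        (e.1 ∉ S ∧ vertexAtZero e ∈ C.supp) ∨
        (e.1 ∈ S ∧ ((vertexAtZero e ∈ C.supp ∧ t < a e) ∨ (vertexAtOne e ∈ C.supp ∧ b e < t)))
    | Point.edgeEnd w => ∃ r : Ray G, r.toEnd = w ∧ r.LiesIn C}

/-- The topology of `ETOP'(G)`, generated by the open sets of open edges and the sets
`C ∪ Ω'(C) ∪ E'(C)` for the components `C` of `G - S`, where `S` is a finite set of edges. -/
instance instTopologicalSpacePoint (G : SimpleGraph V) : TopologicalSpace (Point G) :=
  TopologicalSpace.generateFrom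
    ({O | ∃ (e : G.edgeSet) (U : Set (Set.Ioo (0 : ℝ) 1)), IsOpen U ∧ O = edgeOpen e U} ∪
      {O | ∃ S : Set (Sym2 V), S.Finite ∧ S ⊆ G.edgeSet ∧
        ∃ (C : (G.deleteEdges S).ConnectedComponent) (a b : G.edgeSet → Set.Ioo (0 : ℝ) 1),
          O = componentOpen C a b})

/-- The space `ETOP(G)`, obtained from `ETOP'(G)` by identifying any two points that have the same
open neighbourhoods; it carries the quotient topology. -/
abbrev ETOP (G : SimpleGraph V) : Type _ := SeparationQuotient (Point G)

end EdgeTop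

/-! An ultrafilter on `ETOP'(G)` that contains the interior of an edge converges, because a closed
edge is a continuous image of `[0, 1]`. Any other ultrafilter chooses, for each finite edge set `S`,
one of the finitely many components of `G - S`. These components meet pairwise, and the ultrafilter
converges to any vertex or edge-end that induces the same choice.

Such a point exists. If no vertex lies in all the chosen components, there are finite edge sets
`S₀, S₁, …` such that the component `Cₙ₊₁` chosen for `Sₙ₊₁` contains no endvertex of an edge of
`Sₙ`, and `C₀` misses some vertex `v₀`. An edge that leaves `Cₙ` lies in `Sₙ`, so a vertex at
distance `n` from `v₀` is not in `Cₙ`. Hence the components `Cₙ` decrease to the empty set, and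
there is a ray that eventually stays in each of them. A finite edge set `T` has no endvertex in
`Cₙ` for large `n`, so `Cₙ`, and with it a tail of the ray, lies in the component chosen for `T`.
-/

namespace EdgeTop

open Filter Topology SimpleGraph

variable {V : Type*} {G : SimpleGraph V}

section Components

theorem supp_subset_supp_of_adj {H H' : SimpleGraph V} {C : H.ConnectedComponent}
    {D : H'.ConnectedComponent}
    (hadj : ∀ u ∈ C.supp, u ∈ D.supp → ∀ v, H.Adj u v → H'.Adj u v)
    (hmeet : (C.supp ∩ D.supp).Nonempty) : C.supp ⊆ D.supp := by
  obtain ⟨x, hxC, hxD⟩ := hmeet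
  intro y hyC
  obtain ⟨p⟩ := C.reachable_of_mem_supp hxC hyC
  induction p with
  | nil => exact hxD
  | @cons u v _ huv _ ih =>
    exact ih (C.mem_supp_of_adj_mem_supp hxC huv)
      (D.mem_supp_of_adj_mem_supp hxD (hadj u hxC hxD v huv)) hyC

/-- The endvertices of the edges in `S`. -/
def endvertices (S : Set (Sym2 V)) : Set V := {v | ∃ e ∈ S, v ∈ e}

theorem finite_endvertices {S : Set (Sym2 V)} (hS : S.Finite) : (endvertices S).Finite := by
  classical
  refine (hS.biUnion fun e _ => e.toFinset.finite_toSet).subset ?_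
  rintro v ⟨e, he, hv⟩
  exact Set.mem_biUnion he (Sym2.mem_toFinset.2 hv)

theorem deleteEdges_adj_of_notMem_endvertices {S : Set (Sym2 V)} {u v : V}
    (hu : u ∉ endvertices S) (huv : G.Adj u v) : (G.deleteEdges S).Adj u v :=
  deleteEdges_adj.2 ⟨huv, fun he => hu ⟨s(u, v), he, Sym2.mem_mk_left u v⟩⟩

theorem finite_connectedComponent_deleteEdges [Finite G.ConnectedComponent] {S : Set (Sym2 V)}
    (hS : S.Finite) : Finite (G.deleteEdges S).ConnectedComponent := by
  set T : Set V := endvertices S ∪ Set.range fun K : G.ConnectedComponent => K.nonempty_supp.some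
  have hT : T.Finite := (finite_endvertices hS).union (Set.finite_range _)
  suffices hmeet : ∀ C : (G.deleteEdges S).ConnectedComponent, ∃ t ∈ T, t ∈ C.supp from
    Set.finite_univ_iff.1 <| (hT.image (G.deleteEdges S).connectedComponentMk).subset
      fun C _ => hmeet C
  intro C
  by_contra! hC
  obtain ⟨v, hv⟩ := C.nonempty_supp
  have hKC : (G.connectedComponentMk v).supp ⊆ C.supp :=
    supp_subset_supp_of_adj
      (fun u _ hu _ huw => deleteEdges_adj_of_notMem_endvertices (fun h => hC u (.inl h) hu) huw)
      ⟨v, rfl, hv⟩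
  exact hC _ (.inr ⟨_, rfl⟩) (hKC (G.connectedComponentMk v).nonempty_supp.some_mem)

end Components

section RayConstruction

theorem exists_injective_seq_tendsto_atTop {α : Type*} [Nonempty α] {r : α → α → Prop}
    {rank dist : α → ℕ}
    (hstep : ∀ a, ∃ b, r a b ∧ (rank a < rank b ∨ rank a = rank b ∧ dist b < dist a)) :
    ∃ u : ℕ → α, Function.Injective u ∧ (∀ n, r (u n) (u (n + 1))) ∧
      Tendsto (fun n => rank (u n)) atTop atTop := by
  choose f hrf hf using hstep
  set u : ℕ → α := fun n => f^[n] (Classical.arbitrary α)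
  have hu : ∀ n, u (n + 1) = f (u n) := fun n => Function.iterate_succ_apply' f n _
  have hlex : StrictMono fun n => toLex (rank (u n), OrderDual.toDual (dist (u n))) :=
    strictMono_nat_of_lt_succ fun n => by
      rw [Prod.Lex.toLex_lt_toLex, hu]
      exact hf (u n)
  have hmono : Monotone fun n => rank (u n) :=
    monotone_nat_of_le_succ fun n => by
      rw [hu]
      exact (hf (u n)).elim le_of_lt fun h => h.1.le
  refine ⟨u, fun i j hij => hlex.injective (by simp only [hij]), fun n => hu n ▸ hrf (u n),
    tendsto_atTop_atTop_of_monotone hmono ?_⟩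
  by_contra! hbdd
  obtain ⟨b, hb⟩ := hbdd
  obtain ⟨n, hn⟩ := WellFounded.not_rel_apply_succ (r := (· < ·))
    fun n => toLex (b - rank (u n), dist (u n))
  refine hn (Prod.Lex.toLex_lt_toLex.2 ?_)
  rw [hu]
  rcases hf (u n) with h | ⟨h, h'⟩
  · exact .inl (Nat.sub_lt_sub_left (hb n) h)
  · exact .inr ⟨by rw [h], h'⟩

theorem exists_adj_dist_lt {H : SimpleGraph V} {u x : V} (h : H.Reachable u x) (hne : u ≠ x) :
    ∃ v, H.Adj u v ∧ H.dist v x < H.dist u x := by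
  obtain ⟨p, hp⟩ := h.exists_walk_length_eq_dist
  obtain ⟨v, huv, q, rfl⟩ := p.exists_eq_cons_of_ne hne
  refine ⟨v, huv, (dist_le q).trans_lt ?_⟩
  rw [← hp, Walk.length_cons]
  exact Nat.lt_succ_self _

theorem exists_ray_eventually_mem_supp {H : ℕ → SimpleGraph V} (hH : ∀ n, H n ≤ G)
    {C : ∀ n, (H n).ConnectedComponent} (hanti : Antitone fun n => (C n).supp)
    (hempty : ∀ v, ∃ n, v ∉ (C n).supp) :
    ∃ r : Ray G, ∀ n, ∀ᶠ i in atTop, r.vert i ∈ (C n).supp := by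
  have hlevel : ∀ v : (C 0).supp, ∃ n, v.1 ∈ (C n).supp ∧ v.1 ∉ (C (n + 1)).supp := by
    intro v
    by_contra! hsucc
    obtain ⟨n, hn⟩ := hempty v
    exact hn (Nat.rec v.2 hsucc n)
  choose level hlevel hlevel' using hlevel
  have le_level : ∀ (v : (C 0).supp) {n}, v.1 ∈ (C n).supp → n ≤ level v := fun v n hv =>
    not_lt.1 fun hlt => hlevel' v (hanti hlt hv)
  choose x hx using fun n => (C n).nonempty_supp
  -- Move towards the next component along a shortest path inside the current one.
  have hstep : ∀ u : (C 0).supp, ∃ v : (C 0).supp, G.Adj u v ∧ (level u < level v ∨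
      level u = level v ∧ (H (level v)).dist v (x (level v + 1)) <
        (H (level u)).dist u (x (level u + 1))) := by
    intro u
    have hreach : (H (level u)).Reachable u (x (level u + 1)) :=
      (C (level u)).reachable_of_mem_supp (hlevel u) (hanti (Nat.le_succ _) (hx _))
    have hne : u.1 ≠ x (level u + 1) := fun h => hlevel' u (h ▸ hx _)
    obtain ⟨v, huv, hdist⟩ := exists_adj_dist_lt hreach hne
    have hv : v ∈ (C (level u)).supp := (C _).mem_supp_of_adj_mem_supp (hlevel u) huv
    refine ⟨⟨v, hanti (Nat.zero_le _) hv⟩, hH _ huv, ?_⟩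
    exact (le_level ⟨v, _⟩ hv).lt_or_eq.imp_right fun h => ⟨h, h ▸ hdist⟩
  have : Nonempty (C 0).supp := (C 0).nonempty_supp.to_subtype
  obtain ⟨u, hinj, hadj, htop⟩ := exists_injective_seq_tendsto_atTop hstep
  refine ⟨⟨fun n => u n, Subtype.val_injective.comp hinj, hadj⟩, fun n => ?_⟩
  exact (htop.eventually_ge_atTop n).mono fun i hi => hanti hi (hlevel (u i))

end RayConstruction

section EdgeEnds

theorem Ray.exists_tail_liesIn_iff (r : Ray G) {S : Set (Sym2 V)} (hS : S.Finite)
    {C : (G.deleteEdges S).ConnectedComponent} :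
    (∃ k, (r.tail k).LiesIn C) ↔ ∀ᶠ n in atTop, r.vert n ∈ C.supp := by
  constructor
  · rintro ⟨k, hk⟩
    filter_upwards [eventually_ge_atTop k] with n hn
    obtain ⟨i, rfl⟩ := Nat.exists_eq_add_of_le hn
    exact hk.1 i
  · intro hC
    obtain ⟨D, k, hk⟩ := r.exists_tail_liesIn hS
    obtain ⟨n, hnC, hkn⟩ := (hC.and (eventually_ge_atTop k)).exists
    obtain ⟨i, rfl⟩ := Nat.exists_eq_add_of_le hkn
    obtain rfl := ConnectedComponent.eq_of_common_vertex (hk.1 i) hnC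
    exact ⟨k, hk⟩

theorem Ray.toEnd_tail (r : Ray G) (k : ℕ) : (r.tail k).toEnd = r.toEnd := by
  refine Quotient.sound fun S hS _ => ?_
  obtain ⟨C, hC⟩ := r.exists_tail_liesIn hS
  have hr := (r.exists_tail_liesIn_iff hS).1 hC
  exact ⟨C, ((r.tail k).exists_tail_liesIn_iff hS).2
    ((tendsto_atTop_mono (Nat.le_add_left · k) tendsto_id).eventually hr), hC⟩

/-- The finite sets of edges of `G`. -/
abbrev FiniteEdgeSet (G : SimpleGraph V) : Type _ :=
  {S : Set (Sym2 V) // S.Finite ∧ S ⊆ G.edgeSet}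

/-- The component of `G - S` in which the rays of the edge-end `w` have tails. -/
noncomputable def EdgeEnd.component (w : EdgeEnd G) (S : FiniteEdgeSet G) :
    (G.deleteEdges S.1).ConnectedComponent :=
  Quotient.lift (fun r : Ray G => (r.exists_tail_liesIn S.2.1).choose)
    (fun r r' h => by
      obtain ⟨C, ⟨k, hk⟩, l, hl⟩ := h S.1 S.2.1 S.2.2
      obtain ⟨i, hi⟩ := (r.exists_tail_liesIn S.2.1).choose_spec
      obtain ⟨j, hj⟩ := (r'.exists_tail_liesIn S.2.1).choose_spec
      exact (r.liesIn_unique hi hk).trans (r'.liesIn_unique hl hj)) w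

theorem Ray.toEnd_component_eq_iff (r : Ray G) {S : FiniteEdgeSet G}
    {C : (G.deleteEdges S.1).ConnectedComponent} :
    r.toEnd.component S = C ↔ ∀ᶠ n in atTop, r.vert n ∈ C.supp := by
  obtain ⟨k, hk⟩ : ∃ k, (r.tail k).LiesIn (r.toEnd.component S) :=
    (r.exists_tail_liesIn S.2.1).choose_spec
  rw [← r.exists_tail_liesIn_iff S.2.1]
  exact ⟨fun h => ⟨k, h ▸ hk⟩, fun ⟨_, hl⟩ => r.liesIn_unique hk hl⟩

theorem EdgeEnd.component_eq_iff (w : EdgeEnd G) {S : FiniteEdgeSet G}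
    {C : (G.deleteEdges S.1).ConnectedComponent} :
    w.component S = C ↔ ∃ r : Ray G, r.toEnd = w ∧ r.LiesIn C := by
  constructor
  · obtain ⟨r, rfl⟩ := Quotient.exists_rep w
    intro h
    obtain ⟨k, hk⟩ := (r.exists_tail_liesIn_iff S.2.1).2 (r.toEnd_component_eq_iff.1 h)
    exact ⟨r.tail k, r.toEnd_tail k, hk⟩
  · rintro ⟨r, rfl, hr⟩
    exact r.toEnd_component_eq_iff.2 (.of_forall hr.1)

end EdgeEnds

section Directions

/-- An edge-direction of `G`: a consistent choice of a component of `G - S` for every finite edge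
set `S`. Consistency is encoded as the requirement that the chosen components meet pairwise; it
implies that they decrease as `S` grows. -/
@[ext]
structure EdgeDirection (G : SimpleGraph V) where
  component (S : FiniteEdgeSet G) : (G.deleteEdges S.1).ConnectedComponent
  inter_nonempty (S T : FiniteEdgeSet G) : ((component S).supp ∩ (component T).supp).Nonempty

namespace EdgeDirection

variable (d : EdgeDirection G)

theorem supp_component_anti {S T : FiniteEdgeSet G} (hST : S.1 ⊆ T.1) :
    (d.component T).supp ⊆ (d.component S).supp :=
  supp_subset_supp_of_adj (fun _ _ _ _ huv => deleteEdges_anti hST huv) (d.inter_nonempty T S)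

theorem supp_component_subset_of_disjoint {S T : FiniteEdgeSet G}
    (hST : Disjoint (endvertices S.1) (d.component T).supp) :
    (d.component T).supp ⊆ (d.component S).supp :=
  supp_subset_supp_of_adj
    (fun _ hu _ _ huv => deleteEdges_adj_of_notMem_endvertices
      (fun hS => hST.notMem_of_mem_left hS hu) (deleteEdges_le _ huv))
    (d.inter_nonempty T S)

theorem exists_disjoint_supp_component (hd : ∀ v, ∃ S, v ∉ (d.component S).supp) {A : Set V}
    (hA : A.Finite) : ∃ S, Disjoint A (d.component S).supp := by
  choose S hS using hd
  have hfin : (⋃ v ∈ A, (S v).1).Finite := hA.biUnion fun v _ => (S v).2.1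
  refine ⟨⟨⋃ v ∈ A, (S v).1, hfin, Set.iUnion₂_subset fun v _ => (S v).2.2⟩, ?_⟩
  refine Set.disjoint_left.2 fun v hvA hv => hS v (d.supp_component_anti ?_ hv)
  exact Set.subset_biUnion_of_mem (u := fun v => (S v).1) hvA

theorem notMem_supp_component_of_walk {S : ℕ → FiniteEdgeSet G}
    (hS : ∀ n, Disjoint (endvertices (S n).1) (d.component (S (n + 1))).supp) {v₀ w : V}
    (hv₀ : v₀ ∉ (d.component (S 0)).supp) (p : G.Walk w v₀) :
    w ∉ (d.component (S p.length)).supp := by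
  induction p with
  | nil => exact hv₀
  | @cons w u _ hwu q ih =>
    intro hw
    have hw' := d.supp_component_subset_of_disjoint (hS q.length) hw
    have hdel : (G.deleteEdges (S q.length).1).Adj w u :=
      deleteEdges_adj_of_notMem_endvertices
        (fun h => (hS q.length).notMem_of_mem_left h hw) hwu
    exact ih hv₀ ((d.component _).mem_supp_of_adj_mem_supp hw' hdel)

theorem exists_seq_antitone_supp_component (hd : ∀ v, ∃ S, v ∉ (d.component S).supp) :
    ∃ S : ℕ → FiniteEdgeSet G, (Antitone fun n => (d.component (S n)).supp) ∧
      ∀ v, ∃ n, v ∉ (d.component (S n)).supp := by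
  choose next hnext using fun S : FiniteEdgeSet G =>
    d.exists_disjoint_supp_component hd (finite_endvertices S.2.1)
  let noEdges : FiniteEdgeSet G := ⟨∅, Set.finite_empty, Set.empty_subset _⟩
  obtain ⟨v₀, hv₀⟩ := (d.component noEdges).nonempty_supp
  obtain ⟨S₀, hS₀⟩ := hd v₀
  let S : ℕ → FiniteEdgeSet G := fun n => next^[n] S₀
  have hS : ∀ n, Disjoint (endvertices (S n).1) (d.component (S (n + 1))).supp := fun n => by
    have hsucc : S (n + 1) = next (S n) := Function.iterate_succ_apply' next n S₀
    exact hsucc ▸ hnext (S n)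
  refine ⟨S, antitone_nat_of_succ_le fun n => d.supp_component_subset_of_disjoint (hS n),
    fun v => ?_⟩
  by_contra! hv
  have hreach : (G.deleteEdges ∅).Reachable v v₀ := (d.component noEdges).reachable_of_mem_supp
    (d.supp_component_anti (Set.empty_subset _) (hv 0)) hv₀
  obtain ⟨p⟩ := hreach.mono (deleteEdges_le ∅)
  exact d.notMem_supp_component_of_walk hS hS₀ p (hv p.length)

theorem exists_ray_eventually_mem_supp_component (hd : ∀ v, ∃ S, v ∉ (d.component S).supp) :
    ∃ r : Ray G, ∀ T, ∀ᶠ i in atTop, r.vert i ∈ (d.component T).supp := by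
  obtain ⟨S, hanti, hempty⟩ := d.exists_seq_antitone_supp_component hd
  obtain ⟨r, hr⟩ := exists_ray_eventually_mem_supp (fun n => deleteEdges_le (S n).1) hanti hempty
  refine ⟨r, fun T => ?_⟩
  have hleave : ∀ v, ∀ᶠ n in atTop, v ∉ (d.component (S n)).supp := fun v => by
    obtain ⟨n, hn⟩ := hempty v
    filter_upwards [eventually_ge_atTop n] with m hm using fun h => hn (hanti hm h)
  obtain ⟨n, hn⟩ :=
    ((finite_endvertices T.2.1).eventually_all.2 fun v _ => hleave v).exists
  exact (hr n).mono fun _ hi =>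
    d.supp_component_subset_of_disjoint (Set.disjoint_left.2 hn) hi

end EdgeDirection

/-- The component of `G - S` to which the point `p` belongs. An inner point of an edge is assigned
the component of the endvertex at `0`; this choice matters only for the edges in `S`. -/
noncomputable def Point.component (p : Point G) (S : FiniteEdgeSet G) :
    (G.deleteEdges S.1).ConnectedComponent :=
  match p with
  | .vertex v => (G.deleteEdges S.1).connectedComponentMk v
  | .inner e _ => (G.deleteEdges S.1).connectedComponentMk (vertexAtZero e)
  | .edgeEnd w => w.component S

/-- The edge-direction induced by a point of `ETOP'(G)`. -/
noncomputable def Point.direction (p : Point G) : EdgeDirection G where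
  component := p.component
  inter_nonempty S T := by
    rcases p with v | ⟨e, t⟩ | w
    · exact ⟨v, rfl, rfl⟩
    · exact ⟨vertexAtZero e, rfl, rfl⟩
    · obtain ⟨r, rfl⟩ := Quotient.exists_rep w
      obtain ⟨n, hn⟩ := ((r.toEnd_component_eq_iff (S := S)).1 rfl).and
        ((r.toEnd_component_eq_iff (S := T)).1 rfl) |>.exists
      exact ⟨r.vert n, hn⟩

theorem EdgeDirection.exists_direction_eq (d : EdgeDirection G) :
    ∃ p : Point G, p.direction = d ∧ ∀ e, p ∉ edgeOpen e Set.univ := by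
  by_cases hd : ∃ v, ∀ S, v ∈ (d.component S).supp
  · obtain ⟨v, hv⟩ := hd
    refine ⟨.vertex v, EdgeDirection.ext (funext hv), ?_⟩
    rintro e ⟨_, _, ⟨⟩⟩
  · push Not at hd
    obtain ⟨r, hr⟩ := d.exists_ray_eventually_mem_supp_component hd
    refine ⟨.edgeEnd r.toEnd,
      EdgeDirection.ext (funext fun S => r.toEnd_component_eq_iff.2 (hr S)), ?_⟩
    rintro e ⟨_, _, ⟨⟩⟩

end Directions

section Convergence

theorem mem_componentOpen_iff {S : FiniteEdgeSet G} (C : (G.deleteEdges S.1).ConnectedComponent)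
    (a b : G.edgeSet → Set.Ioo (0 : ℝ) 1) {p : Point G}
    (hp : ∀ e : G.edgeSet, e.1 ∈ S.1 → p ∉ edgeOpen e Set.univ) :
    p ∈ componentOpen C a b ↔ p.direction.component S = C := by
  rcases p with v | ⟨e, t⟩ | w
  · exact Iff.rfl
  · have he : e.1 ∉ S.1 := fun he => hp e he ⟨t, trivial, rfl⟩
    exact ⟨fun h => (h.resolve_right fun h' => he h'.1).2, fun h => .inl ⟨he, h⟩⟩
  · exact w.component_eq_iff.symm

theorem le_nhds_of_eventually_direction_eq {F : Filter (Point G)} {p : Point G}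
    (hF : ∀ e, ∀ᶠ q in F, q ∉ edgeOpen e Set.univ) (hp : ∀ e, p ∉ edgeOpen e Set.univ)
    (hdir : ∀ S, ∀ᶠ q in F, q.direction.component S = p.direction.component S) : F ≤ 𝓝 p := by
  rw [TopologicalSpace.nhds_generateFrom]
  refine le_iInf₂ fun O hO => le_principal_iff.2 ?_
  rcases hO with ⟨hpO, ⟨e, U, -, rfl⟩ | ⟨S, hS, hSG, C, a, b, rfl⟩⟩
  · obtain ⟨t, -, rfl⟩ := hpO
    exact absurd ⟨t, trivial, rfl⟩ (hp e)
  · have hpC := (mem_componentOpen_iff (S := ⟨S, hS, hSG⟩) C a b fun e _ => hp e).1 hpO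
    have hFS : ∀ᶠ q in F, ∀ e ∈ {e : G.edgeSet | e.1 ∈ S}, q ∉ edgeOpen e Set.univ :=
      (hS.preimage Subtype.val_injective.injOn).eventually_all.2 fun e _ => hF e
    filter_upwards [hFS, hdir ⟨S, hS, hSG⟩] with q hqS hq
    exact (mem_componentOpen_iff (S := ⟨S, hS, hSG⟩) C a b hqS).2 (hq.trans hpC)

theorem exists_eventually_direction_eq [Finite G.ConnectedComponent] (F : Ultrafilter (Point G)) :
    ∃ d : EdgeDirection G, ∀ S, ∀ᶠ p : Point G in F, p.direction.component S = d.component S := by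
  have hconst : ∀ S : FiniteEdgeSet G,
      ∃ C, ∀ᶠ p : Point G in F, p.direction.component S = C := fun S => by
    have := finite_connectedComponent_deleteEdges (G := G) S.2.1
    exact Ultrafilter.eventually_exists_iff.1
      (.of_forall fun p : Point G => ⟨p.direction.component S, rfl⟩)
  choose C hC using hconst
  refine ⟨⟨C, fun S T => ?_⟩, hC⟩
  obtain ⟨p, hS, hT⟩ := ((hC S).and (hC T)).exists
  exact hS ▸ hT ▸ p.direction.inter_nonempty S T

end Convergence

section ClosedEdges

theorem vertexAtOne_mem_supp_iff {S : Set (Sym2 V)} (C : (G.deleteEdges S).ConnectedComponent)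
    {e : G.edgeSet} (he : e.1 ∉ S) : vertexAtOne e ∈ C.supp ↔ vertexAtZero e ∈ C.supp := by
  refine (C.mem_supp_congr_adj ?_).symm
  rw [deleteEdges_adj, ← mem_edgeSet, mk_vertexAtZero_vertexAtOne]
  exact ⟨e.2, he⟩

/-- The parametrization of the closed edge `e` by `[0, 1]`, extended constantly to `ℝ`. -/
noncomputable def edgePath (e : G.edgeSet) (x : ℝ) : Point G :=
  if h₀ : x ≤ 0 then .vertex (vertexAtZero e)
  else if h₁ : 1 ≤ x then .vertex (vertexAtOne e)
  else .inner e ⟨x, not_le.1 h₀, not_le.1 h₁⟩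

theorem edgePath_of_mem_Ioo (e : G.edgeSet) (t : Set.Ioo (0 : ℝ) 1) :
    edgePath e t = .inner e t := by
  rw [edgePath, dif_neg t.2.1.not_ge, dif_neg t.2.2.not_ge]

theorem edgePath_mem_edgeOpen_iff {e e' : G.edgeSet} {U : Set (Set.Ioo (0 : ℝ) 1)} {x : ℝ} :
    edgePath e x ∈ edgeOpen e' U ↔ e = e' ∧ x ∈ Subtype.val '' U := by
  unfold edgePath
  split_ifs with h₀ h₁
  · refine ⟨?_, ?_⟩
    · rintro ⟨_, _, ⟨⟩⟩
    · rintro ⟨_, t, _, rfl⟩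
      exact absurd t.2.1 h₀.not_gt
  · refine ⟨?_, ?_⟩
    · rintro ⟨_, _, ⟨⟩⟩
    · rintro ⟨_, t, _, rfl⟩
      exact absurd t.2.2 h₁.not_gt
  · refine ⟨?_, ?_⟩
    · rintro ⟨t, ht, ⟨⟩⟩
      exact ⟨rfl, _, ht, rfl⟩
    · rintro ⟨rfl, t, ht, rfl⟩
      exact ⟨t, ht, rfl⟩

theorem edgePath_mem_componentOpen_iff_of_notMem {S : Set (Sym2 V)}
    (C : (G.deleteEdges S).ConnectedComponent) (a b : G.edgeSet → Set.Ioo (0 : ℝ) 1)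
    {e : G.edgeSet} (he : e.1 ∉ S) (x : ℝ) :
    edgePath e x ∈ componentOpen C a b ↔ vertexAtZero e ∈ C.supp := by
  unfold edgePath
  split_ifs
  · exact Iff.rfl
  · exact vertexAtOne_mem_supp_iff C he
  · exact ⟨fun h => (h.resolve_right fun h' => he h'.1).2, fun h => .inl ⟨he, h⟩⟩

theorem edgePath_mem_componentOpen_iff_of_mem {S : Set (Sym2 V)}
    (C : (G.deleteEdges S).ConnectedComponent) (a b : G.edgeSet → Set.Ioo (0 : ℝ) 1)
    {e : G.edgeSet} (he : e.1 ∈ S) (x : ℝ) :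
    edgePath e x ∈ componentOpen C a b ↔
      vertexAtZero e ∈ C.supp ∧ x < a e ∨ vertexAtOne e ∈ C.supp ∧ b e < x := by
  have ha := (a e).2
  have hb := (b e).2
  unfold edgePath
  split_ifs with h₀ h₁
  · have hxa : x < a e := h₀.trans_lt ha.1
    have hbx : ¬b e < x := (h₀.trans hb.1.le).not_gt
    simp only [hxa, hbx, and_true, and_false, or_false]
    exact Iff.rfl
  · have hxa : ¬x < a e := (ha.2.le.trans h₁).not_gt
    have hbx : b e < x := hb.2.trans_le h₁
    simp only [hxa, hbx, and_true, and_false, false_or]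
    exact Iff.rfl
  · exact ⟨fun h => (h.resolve_left fun h' => h'.1 he).2, fun h => .inr ⟨he, h⟩⟩

theorem continuous_edgePath (e : G.edgeSet) : Continuous (edgePath e) := by
  refine continuous_generateFrom_iff.2 ?_
  rintro _ (⟨e', U, hU, rfl⟩ | ⟨S, -, -, C, a, b, rfl⟩)
  · simp only [Set.preimage, edgePath_mem_edgeOpen_iff]
    exact isOpen_const.and (isOpen_Ioo.isOpenMap_subtype_val U hU)
  · by_cases he : e.1 ∈ S
    · simp only [Set.preimage, edgePath_mem_componentOpen_iff_of_mem C a b he]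
      exact (isOpen_const.and isOpen_Iio).union (isOpen_const.and isOpen_Ioi)
    · simp only [Set.preimage, edgePath_mem_componentOpen_iff_of_notMem C a b he]
      exact isOpen_const

theorem exists_le_nhds_of_edgeOpen_mem {F : Ultrafilter (Point G)} {e : G.edgeSet}
    (he : edgeOpen e Set.univ ∈ F) : ∃ p : Point G, ↑F ≤ 𝓝 p := by
  have hcompact : IsCompact (edgePath e '' Set.Icc 0 1) :=
    isCompact_Icc.image (continuous_edgePath e)
  have hsub : edgeOpen e Set.univ ⊆ edgePath e '' Set.Icc 0 1 := by
    rintro _ ⟨t, -, rfl⟩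
    exact ⟨t, Set.Ioo_subset_Icc_self t.2, edgePath_of_mem_Ioo e t⟩
  obtain ⟨p, -, hp⟩ := hcompact.ultrafilter_le_nhds' F (mem_of_superset he hsub)
  exact ⟨p, hp⟩

end ClosedEdges

theorem compactSpace_point (G : SimpleGraph V) [Finite G.ConnectedComponent] :
    CompactSpace (Point G) := by
  suffices hlim : ∀ F : Ultrafilter (Point G), ∃ p, (F : Filter (Point G)) ≤ 𝓝 p from
    ⟨isCompact_iff_ultrafilter_le_nhds.2 fun F _ => (hlim F).imp fun _ hp => ⟨trivial, hp⟩⟩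
  intro F
  by_cases hF : ∃ e, edgeOpen e Set.univ ∈ F
  · obtain ⟨e, he⟩ := hF
    exact exists_le_nhds_of_edgeOpen_mem he
  · push Not at hF
    obtain ⟨d, hd⟩ := exists_eventually_direction_eq F
    obtain ⟨p, rfl, hp⟩ := d.exists_direction_eq
    exact ⟨p, le_nhds_of_eventually_direction_eq
      (fun e => Ultrafilter.compl_mem_iff_notMem.2 (hF e)) hp hd⟩

end EdgeTop

theorem mainTheorem9_general {V : Type*} (G : SimpleGraph V) [Finite G.ConnectedComponent] :
    CompactSpace (EdgeTop.ETOP G) :=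
  have := EdgeTop.compactSpace_point G
  Quotient.compactSpace

theorem mainTheorem9 {V : Type*} [Countable V] (G : SimpleGraph V) (hG : G.Connected) :
    CompactSpace (EdgeTop.ETOP G) := by
  have := hG.preconnected.subsingleton_connectedComponent
  exact mainTheorem9_general G
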